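/- A Motzkin path from $(0,0)$ to $(n,0)$ is a lattice path that starts at $(0,0)$, ends at $(n,0)$, has $n$ steps, each of the form $(x,y)\to(x+1,y+1)$, $(x,y)\to(x+1,y)$ or $(x,y)\to(x+1,y-1)$, and never goes strictly below the $x$-axis. Let $\mathrm{Motzkin}(n)$ be the (finite) set of these paths, let $\mathrm{Area}(P)$ be the area of the region between $P$ and the $x$-axis, and for integers $r,n\ge 0$ let $$M_r(n):=\sum_{P\in \mathrm{Motzkin}(n)}\mathrm{Area}(P)^r ,$$ with the convention $0^0=1$. Let $M_n:=|\mathrm{Motzkin}(n)|=M_0(n)$ be the Motzkin numbers. For every integer $r\ge 0$ there exist polynomials $Q_1,Q_2,Q_3,Q_4$ with rational coefficients (depending on $r$) such that, for all integers $n\ge 0$, $$M_r(n)=Q_1(n)\,M_n+Q_2(n)\,M_{n+1}+Q_3(n)\,3^n+Q_4(n)\,(-1)^n .$$ -/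

import Mathlib

/-- The height after the first `k` steps of the lattice path that starts at `(0, 0)` and whose
`i`-th step is `(x, y) → (x + 1, y + w i)`. -/
def pathHeight {n : ℕ} (w : Fin n → ℤ) (k : ℕ) : ℤ :=
  ∑ i : Fin n with i.val < k, w i

/-- The Motzkin paths from `(0, 0)` to `(n, 0)`, as sequences of `n` steps in `{-1, 0, 1}` whose
partial sums are nonnegative and whose total sum is `0`. -/
def motzkinPaths (n : ℕ) : Finset (Fin n → ℤ) :=
  {w ∈ Fintype.piFinset fun _ : Fin n => ({-1, 0, 1} : Finset ℤ) |
    (∀ k ≤ n, 0 ≤ pathHeight w k) ∧ pathHeight w n = 0}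

/-- The area between the path and the `x`-axis: the region above `[k, k + 1]` is a trapezoid of
width `1` whose parallel sides are the heights of the path at `k` and at `k + 1`. -/
def pathArea {n : ℕ} (w : Fin n → ℤ) : ℚ :=
  ∑ k ∈ Finset.range n, ((pathHeight w k : ℚ) + (pathHeight w (k + 1) : ℚ)) / 2

/-- `M_r(n)`, the sum of the `r`-th powers of the areas under the Motzkin paths from `(0, 0)` to
`(n, 0)`. -/
def motzkinAreaPowerSum (r n : ℕ) : ℚ :=
  ∑ w ∈ motzkinPaths n, pathArea w ^ r

/-- The Motzkin number `M_n`, the number of Motzkin paths from `(0, 0)` to `(n, 0)`. -/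
def motzkinNumber (n : ℕ) : ℕ :=
  (motzkinPaths n).card

/-! Let F(x) be the sum of x^n q^Area(P) over all Motzkin paths P, with q = e^t. Splitting a path at
its first return to the axis gives F(x) = 1 + x F(x) + q x² F(qx) F(x), and M_r(n) / r! is the
coefficient of x^n t^r.

Put M = F at t = 0, u = xM and θ = x d/dx, so that M = 1 + u + u². In the coefficient of t^r the
substitution x → qx turns into powers of θ, and the unknown F_r occurs linearly with factor 1 - x -
2x²M = (1 - u²)/M. As θ preserves M·R for R = ℚ[1/(1-u), 1/(1+u)], induction puts every F_r in M·R
(`tCoeff_areaGF_mem`).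

Every element of M·R has coefficients of the required form (`resolventAlg_le_motzkinMultipliers`).
Partial fractions leave pure powers of 1/(1-u) and 1/(1+u). The squares give M/(1-u)² = 1/(1-3x) and
M/(1+u)² = 1/(1+x), the source of 3^n and (-1)^n. The simple poles come from θ applied to M and
M(1+u), the series of M_n and M_{n+1}. Higher powers follow because θ raises the pole order by two
while only multiplying the n-th coefficient by n. -/

open PowerSeries

/-! ### Paths from arbitrary height: removing the first step -/

/-- The steps of the paths with `n` steps from height `h` to height `0` that stay weakly above
the `x`-axis. -/
def motzkinPathsFrom (h : ℤ) (n : ℕ) : Finset (Fin n → ℤ) :=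
  {w ∈ Fintype.piFinset fun _ : Fin n => ({-1, 0, 1} : Finset ℤ) |
    (∀ k ≤ n, 0 ≤ h + pathHeight w k) ∧ h + pathHeight w n = 0}

theorem motzkinPathsFrom_zero (n : ℕ) : motzkinPathsFrom 0 n = motzkinPaths n := by
  simp [motzkinPathsFrom, motzkinPaths]

theorem pathHeight_zero {n : ℕ} (w : Fin n → ℤ) : pathHeight w 0 = 0 := by
  simp [pathHeight]

theorem pathHeight_cons_succ {n : ℕ} (d : ℤ) (w : Fin n → ℤ) (k : ℕ) :
    pathHeight (Fin.cons d w : Fin (n + 1) → ℤ) (k + 1) = d + pathHeight w k := by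
  simp [pathHeight, Finset.sum_filter, Fin.sum_univ_succ]

theorem pathArea_cons {n : ℕ} (d : ℤ) (w : Fin n → ℤ) :
    pathArea (Fin.cons d w : Fin (n + 1) → ℤ) = d / 2 + d * n + pathArea w := by
  unfold pathArea
  rw [Finset.sum_range_succ']
  simp only [pathHeight_cons_succ, pathHeight_zero]
  have : ∀ k : ℕ, (((d + pathHeight w k : ℤ) : ℚ) + ((d + pathHeight w (k + 1) : ℤ) : ℚ)) / 2
      = d + ((pathHeight w k : ℚ) + (pathHeight w (k + 1) : ℚ)) / 2 := by
    intro k; push_cast; ring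
  simp only [this, Finset.sum_add_distrib]
  simp
  ring

theorem cons_mem_motzkinPathsFrom {h : ℤ} (hh : 0 ≤ h) {n : ℕ} (d : ℤ) (w : Fin n → ℤ) :
    (Fin.cons d w : Fin (n + 1) → ℤ) ∈ motzkinPathsFrom h (n + 1) ↔
      d ∈ ({-1, 0, 1} : Finset ℤ) ∧ w ∈ motzkinPathsFrom (h + d) n := by
  have key : (∀ k ≤ n + 1, 0 ≤ h + pathHeight (Fin.cons d w : Fin (n + 1) → ℤ) k) ↔
      ∀ k ≤ n, 0 ≤ h + d + pathHeight w k := by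
    constructor
    · intro H k hk
      have := H (k + 1) (by omega)
      rw [pathHeight_cons_succ] at this
      omega
    · rintro H (_ | k) hk
      · simpa [pathHeight_zero] using hh
      · rw [pathHeight_cons_succ]
        have := H k (by omega)
        omega
  simp only [motzkinPathsFrom, Finset.mem_filter, key, pathHeight_cons_succ, Fintype.mem_piFinset,
    Fin.forall_fin_succ, Fin.cons_zero, Fin.cons_succ, add_assoc, and_assoc]

theorem sum_motzkinPathsFrom_succ {M : Type*} [AddCommMonoid M] {h : ℤ} (hh : 0 ≤ h) {n : ℕ}
    (φ : (Fin (n + 1) → ℤ) → M) :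
    ∑ w ∈ motzkinPathsFrom h (n + 1), φ w =
      ∑ d ∈ ({-1, 0, 1} : Finset ℤ), ∑ w ∈ motzkinPathsFrom (h + d) n, φ (Fin.cons d w) := by
  rw [Finset.sum_sigma']
  refine Finset.sum_bij' (fun w _ => ⟨w 0, Fin.tail w⟩) (fun p _ => Fin.cons p.1 p.2) ?_ ?_ ?_ ?_ ?_
  · intro w hw
    rw [← Fin.cons_self_tail w, cons_mem_motzkinPathsFrom hh] at hw
    simpa only [Finset.mem_sigma] using hw
  · rintro ⟨d, w⟩ hw
    rw [cons_mem_motzkinPathsFrom hh]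
    simpa only [Finset.mem_sigma] using hw
  · intro w _; simp
  · rintro ⟨d, w⟩ _; simp
  · intro w _; simp

theorem motzkinPathsFrom_of_neg {h : ℤ} (hh : h < 0) (n : ℕ) : motzkinPathsFrom h n = ∅ := by
  refine Finset.filter_eq_empty_iff.2 fun w _ H => ?_
  have := H.1 0 (Nat.zero_le _)
  rw [pathHeight_zero] at this
  omega

/-! ### Exponential area weights -/

/-- The power series `exp (a t)`. -/
noncomputable def expMul (a : ℚ) : ℚ⟦X⟧ := rescale a (exp ℚ)

theorem coeff_expMul (a : ℚ) (r : ℕ) : coeff r (expMul a) = a ^ r / r.factorial := by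
  simp [expMul, coeff_exp, div_eq_mul_inv]

theorem expMul_add (a b : ℚ) : expMul (a + b) = expMul a * expMul b :=
  (exp_mul_exp_eq_exp_add a b).symm

theorem expMul_zero : expMul 0 = 1 := by
  ext r
  rw [coeff_expMul, coeff_one]
  rcases r with _ | r <;> simp

theorem expMul_natCast (n : ℕ) : expMul n = expMul 1 ^ n := by
  induction n with
  | zero => simp [expMul_zero]
  | succ n ih => rw [Nat.cast_succ, expMul_add, ih, pow_succ]

/-- The sum of `exp (area * t)` over the paths with `n` steps from height `h` to height `0`. -/
noncomputable def areaSumFrom (h : ℤ) (n : ℕ) : ℚ⟦X⟧ :=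
  ∑ w ∈ motzkinPathsFrom h n, expMul (pathArea w + h * n)

theorem areaSumFrom_of_neg {h : ℤ} (hh : h < 0) (n : ℕ) : areaSumFrom h n = 0 := by
  simp [areaSumFrom, motzkinPathsFrom_of_neg hh]

theorem areaSumFrom_zero_right {h : ℤ} (hh : 0 ≤ h) :
    areaSumFrom h 0 = if h = 0 then 1 else 0 := by
  unfold areaSumFrom motzkinPathsFrom
  rw [Finset.sum_filter]
  simp [pathHeight, pathArea, expMul_zero, hh]

/-- First-step decomposition. `pathArea` measures from the starting level, hence the correction `h *
n` in `areaSumFrom`; a first step `d` then contributes its own trapezoid, of area `h + d / 2`. -/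
theorem areaSumFrom_succ {h : ℤ} (hh : 0 ≤ h) (n : ℕ) :
    areaSumFrom h (n + 1) = expMul (h - 1 / 2) * areaSumFrom (h - 1) n
      + expMul h * areaSumFrom h n + expMul (h + 1 / 2) * areaSumFrom (h + 1) n := by
  have key : ∀ d : ℤ, ∑ w ∈ motzkinPathsFrom (h + d) n,
      expMul (pathArea (Fin.cons d w : Fin (n + 1) → ℤ) + h * (n + 1 : ℕ)) =
      expMul (h + d / 2) * areaSumFrom (h + d) n := by
    intro d
    rw [areaSumFrom, Finset.mul_sum]
    refine Finset.sum_congr rfl fun w _ => ?_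
    rw [← expMul_add, pathArea_cons]
    congr 1
    push_cast
    ring
  rw [areaSumFrom, sum_motzkinPathsFrom_succ hh]
  simp only [key]
  rw [Finset.sum_insert (by simp), Finset.sum_insert (by simp), Finset.sum_singleton]
  simp only [Int.cast_neg, Int.cast_one, Int.cast_zero, zero_div, add_zero, neg_div, ← sub_eq_add_neg]
  ring

/-! ### The functional equation and its combinatorial meaning -/

/-- The coefficients of the solution of `f(x) = 1 + x f(x) + q x² f(q x) f(x)`. -/
def qMotzkin {K : Type*} [CommRing K] (q : K) : ℕ → K
  | 0 => 1
  | 1 => 1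
  | n + 2 => qMotzkin q (n + 1) +
      ∑ p ∈ (Finset.HasAntidiagonal.antidiagonal n).attach, q ^ (p.1.1 + 1) * qMotzkin q p.1.1 * qMotzkin q p.1.2
  decreasing_by
    · omega
    · have := Finset.HasAntidiagonal.mem_antidiagonal.1 p.2; omega
    · have := Finset.HasAntidiagonal.mem_antidiagonal.1 p.2; omega

theorem qMotzkin_add_two {K : Type*} [CommRing K] (q : K) (n : ℕ) :
    qMotzkin q (n + 2) = qMotzkin q (n + 1) +
      ∑ p ∈ Finset.HasAntidiagonal.antidiagonal n, q ^ (p.1 + 1) * qMotzkin q p.1 * qMotzkin q p.2 := by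
  rw [qMotzkin, Finset.sum_attach (Finset.HasAntidiagonal.antidiagonal n)
    (fun p => q ^ (p.1 + 1) * qMotzkin q p.1 * qMotzkin q p.2)]

theorem mk_qMotzkin {K : Type*} [CommRing K] (q : K) :
    mk (qMotzkin q) = 1 + X * mk (qMotzkin q)
      + X ^ 2 * (C q * rescale q (mk (qMotzkin q)) * mk (qMotzkin q)) := by
  ext n
  rcases n with _ | _ | n
  · simp [qMotzkin]
  · rw [map_add, map_add, zero_add, ← zero_add 1, coeff_succ_X_mul, coeff_X_pow_mul']
    simp [qMotzkin, coeff_one]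
  · rw [map_add, map_add, coeff_succ_X_mul, add_assoc n 1 1, coeff_X_pow_mul, coeff_mul, coeff_mk,
      qMotzkin_add_two]
    simp only [coeff_mk, coeff_C_mul, coeff_rescale, coeff_one]
    simp only [Nat.reduceAdd, Nat.add_eq_zero_iff, OfNat.ofNat_ne_zero, and_false, if_false,
      zero_add, pow_succ', mul_assoc]

theorem rescale_C_eq {K : Type*} [CommRing K] (a b : K) : rescale a (C b) = C b := by
  ext n
  rw [coeff_rescale, coeff_C]
  split_ifs with h <;> simp [h]

/-- The generating function of Motzkin paths by length and (exponentially) by area. -/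
noncomputable def areaGF : ℚ⟦X⟧⟦X⟧ := mk (qMotzkin (expMul 1))

theorem areaGF_eq : areaGF = 1 + X * areaGF
      + X ^ 2 * (C (expMul 1) * rescale (expMul 1) areaGF * areaGF) :=
  mk_qMotzkin _

/-- The generating function of the paths from height `h` to height `0`. -/
noncomputable def areaGFFrom : ℕ → ℚ⟦X⟧⟦X⟧
  | 0 => areaGF
  | h + 1 => X * (C (expMul (h + 1 / 2)) * rescale (expMul (h + 1)) areaGF * areaGFFrom h)

theorem areaGFFrom_zero_eq : areaGFFrom 0 = 1 + X * (areaGFFrom 0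
    + C (expMul (1 / 2)) * areaGFFrom 1) := by
  have h : expMul 1 = expMul (1 / 2) * expMul (1 / 2) := by rw [← expMul_add]; norm_num
  have h2 : (C (expMul 1) : ℚ⟦X⟧⟦X⟧) = C (expMul (1 / 2)) * C (expMul (1 / 2)) := by
    rw [← map_mul, ← h]
  simp only [areaGFFrom]
  norm_num only [Nat.cast_zero, zero_add]
  conv_lhs => rw [areaGF_eq]
  rw [h2]
  ring

/-- `areaGFFrom` encodes first passage: a path from `h + 1` stays at or above `h + 1` (a Motzkin
path lifted by `h + 1`, whence the rescaling), steps down to `h`, and continues. The functional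
equation at the rescaled variable turns this into the first-step recursion. -/
theorem areaGFFrom_succ_eq (h : ℕ) : areaGFFrom (h + 1) = X * (C (expMul (h + 1 / 2)) * areaGFFrom h
    + C (expMul (h + 1)) * areaGFFrom (h + 1) + C (expMul (h + 3 / 2)) * areaGFFrom (h + 2)) := by
  have h1 := congrArg (rescale (expMul (h + 1))) areaGF_eq
  simp only [map_add, map_mul, map_one, map_pow, rescale_X, rescale_C_eq, rescale_rescale,
    ← expMul_add] at h1
  have h2 : (C (expMul (h + 1)) : ℚ⟦X⟧⟦X⟧) ^ 2 * C (expMul 1) = C (expMul (h + 3 / 2)) ^ 2 := by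
    simp only [← map_pow, ← map_mul]
    simp only [pow_two, ← expMul_add]
    congr 2; ring
  have e : areaGFFrom (h + 2) = X * (C (expMul (h + 3 / 2)) * rescale (expMul (h + 1 + 1)) areaGF
      * areaGFFrom (h + 1)) := by
    rw [areaGFFrom]; push_cast; congr 5; ring
  have e1 : (1 + ((h:ℚ) + 1)) = h + 1 + 1 := by ring
  rw [e]
  rw [areaGFFrom]
  generalize rescale (expMul ((h : ℚ) + 1)) areaGF = F at *
  generalize areaGFFrom h = A at *
  rw [e1] at h1
  generalize rescale (expMul ((h : ℚ) + 1 + 1)) areaGF = G at *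
  linear_combination (X * C (expMul (h + 1 / 2)) * A) * h1 +
    (X ^ 3 * C (expMul (h + 1 / 2)) * A * F * G) * h2

/-- Both sides obey the same first-step recursion, which determines them by induction on the length.
-/
theorem coeff_areaGFFrom (n h : ℕ) : coeff n (areaGFFrom h) = areaSumFrom h n := by
  induction n generalizing h with
  | zero =>
    rw [areaSumFrom_zero_right (by positivity)]
    rcases h with _ | h
    · rw [areaGFFrom_zero_eq]; simp
    · rw [areaGFFrom_succ_eq]
      rw [coeff_zero_X_mul, if_neg (by omega)]
  | succ n ih =>
    rw [areaSumFrom_succ (by positivity)]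
    rcases h with _ | h
    · rw [areaGFFrom_zero_eq, map_add, coeff_succ_X_mul, map_add, coeff_C_mul, ih, ih,
        areaSumFrom_of_neg (h := ((0 : ℕ) : ℤ) - 1) (by simp)]
      simp [coeff_one, expMul_zero]
    · rw [areaGFFrom_succ_eq, coeff_succ_X_mul, map_add, map_add, coeff_C_mul, coeff_C_mul,
        coeff_C_mul, ih, ih, ih]
      push_cast
      congr! 3 <;> ring_nf

theorem coeff_coeff_areaGF (r n : ℕ) :
    coeff r (coeff n areaGF) = motzkinAreaPowerSum r n / r.factorial := by
  have := coeff_areaGFFrom n 0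
  rw [areaGFFrom] at this
  rw [this, areaSumFrom, motzkinAreaPowerSum, map_sum, Finset.sum_div, Nat.cast_zero,
    motzkinPathsFrom_zero]
  simp [coeff_expMul]

/-! ### Coefficients in t and the Euler operator -/

/-- The series of the coefficients of `t ^ r`. -/
noncomputable def tCoeff (r : ℕ) (f : ℚ⟦X⟧⟦X⟧) : ℚ⟦X⟧ := mk fun n => coeff r (coeff n f)

theorem coeff_tCoeff (r n : ℕ) (f : ℚ⟦X⟧⟦X⟧) : coeff n (tCoeff r f) = coeff r (coeff n f) := by
  simp [tCoeff]

theorem tCoeff_add (r : ℕ) (f g : ℚ⟦X⟧⟦X⟧) : tCoeff r (f + g) = tCoeff r f + tCoeff r g := by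
  ext n; simp [coeff_tCoeff]

theorem tCoeff_one (r : ℕ) : tCoeff r 1 = if r = 0 then 1 else 0 := by
  ext n
  rw [coeff_tCoeff, coeff_one]
  split_ifs with h1 h2 h2 <;> simp [coeff_one, h1, h2]

theorem tCoeff_X_pow_mul (r k : ℕ) (f : ℚ⟦X⟧⟦X⟧) : tCoeff r (X ^ k * f) = X ^ k * tCoeff r f := by
  ext n
  rw [coeff_tCoeff, coeff_X_pow_mul', coeff_X_pow_mul', apply_ite (coeff r), map_zero, coeff_tCoeff]

theorem tCoeff_mul (r : ℕ) (f g : ℚ⟦X⟧⟦X⟧) : tCoeff r (f * g) =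
    ∑ p ∈ Finset.HasAntidiagonal.antidiagonal r, tCoeff p.1 f * tCoeff p.2 g := by
  ext n
  simp only [coeff_tCoeff, coeff_mul, map_sum]
  rw [Finset.sum_comm]

/-- The operator `x d/dx`. -/
noncomputable def eulerOp : Derivation ℚ ℚ⟦X⟧ ℚ⟦X⟧ := (X : ℚ⟦X⟧) • derivative ℚ

theorem coeff_eulerOp (n : ℕ) (f : ℚ⟦X⟧) : coeff n (eulerOp f) = n * coeff n f := by
  rw [eulerOp, Derivation.smul_apply, smul_eq_mul]
  rcases n with _ | n
  · simp
  · rw [coeff_succ_X_mul, coeff_derivative]; push_cast; ring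

theorem eulerOp_X_mul (f : ℚ⟦X⟧) : eulerOp (X * f) = X * f + X * eulerOp f := by
  rw [Derivation.leibniz]
  simp [eulerOp]
  ring

/-- The operator `f ↦ f + x f'`, which multiplies the `n`-th coefficient by `n + 1`. -/
noncomputable def succEulerOp : ℚ⟦X⟧ →ₗ[ℚ] ℚ⟦X⟧ := LinearMap.id + eulerOp.toLinearMap

theorem succEulerOp_apply (f : ℚ⟦X⟧) : succEulerOp f = f + eulerOp f := rfl

theorem coeff_succEulerOp_pow (i n : ℕ) (f : ℚ⟦X⟧) :
    coeff n ((succEulerOp ^ i) f) = (n + 1) ^ i * coeff n f := by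
  induction i with
  | zero => simp
  | succ i ih =>
    rw [pow_succ', Module.End.mul_apply, succEulerOp_apply, map_add, coeff_eulerOp, ih]
    ring

/-- The factor q and the rescaling together multiply the n-th coefficient by e^((n+1)t), whose t^i
term is (n+1)^i / i!. -/
theorem tCoeff_rescale (r : ℕ) (f : ℚ⟦X⟧⟦X⟧) :
    tCoeff r (C (expMul 1) * rescale (expMul 1) f) =
      ∑ p ∈ Finset.HasAntidiagonal.antidiagonal r,
        (p.1.factorial : ℚ)⁻¹ • (succEulerOp ^ p.1) (tCoeff p.2 f) := by
  ext n
  rw [coeff_tCoeff, coeff_C_mul, coeff_rescale, ← mul_assoc, ← pow_succ', ← expMul_natCast, coeff_mul,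
    map_sum]
  refine Finset.sum_congr rfl fun p _ => ?_
  rw [coeff_expMul, coeff_smul, coeff_succEulerOp_pow, coeff_tCoeff, smul_eq_mul]
  push_cast
  ring

/-! ### The rational parametrisation by u -/

/-- The generating function of the Motzkin numbers. -/
noncomputable def motzkinGF : ℚ⟦X⟧ := mk fun n => (motzkinNumber n : ℚ)

theorem coeff_motzkinGF (n : ℕ) : coeff n motzkinGF = motzkinNumber n := by simp [motzkinGF]

theorem tCoeff_zero_areaGF : tCoeff 0 areaGF = motzkinGF := by
  ext n
  rw [coeff_tCoeff, coeff_coeff_areaGF, coeff_motzkinGF]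
  simp [motzkinAreaPowerSum, motzkinNumber]

/-- The series `u` with `x = u / (1 + u + u ^ 2)`. -/
noncomputable def conicParam : ℚ⟦X⟧ := X * motzkinGF

theorem motzkinGF_eq : motzkinGF = 1 + conicParam + conicParam ^ 2 := by
  have h := congrArg (tCoeff 0) areaGF_eq
  have hX := tCoeff_X_pow_mul 0 1 areaGF
  rw [pow_one, pow_one] at hX
  rw [tCoeff_add, tCoeff_add, tCoeff_one, hX, tCoeff_X_pow_mul, tCoeff_mul] at h
  simp only [Finset.Nat.antidiagonal_zero, Finset.sum_singleton, tCoeff_rescale] at h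
  simp [tCoeff_zero_areaGF] at h
  rw [conicParam]
  linear_combination h

/-- The series `1 / (1 - u)`. -/
noncomputable def invOneSub : ℚ⟦X⟧ := (1 - conicParam)⁻¹

/-- The series `1 / (1 + u)`. -/
noncomputable def invOneAdd : ℚ⟦X⟧ := (1 + conicParam)⁻¹

theorem invOneSub_mul : invOneSub * (1 - conicParam) = 1 :=
  PowerSeries.inv_mul_cancel _ (by simp [conicParam])

theorem invOneAdd_mul : invOneAdd * (1 + conicParam) = 1 :=
  PowerSeries.inv_mul_cancel _ (by simp [conicParam])

theorem C_ofNat (n : ℕ) [n.AtLeastTwo] : (C (OfNat.ofNat n : ℚ) : ℚ⟦X⟧) = OfNat.ofNat n :=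
  map_ofNat C n

theorem eulerOp_conicParam :
    eulerOp conicParam = conicParam * motzkinGF * (invOneSub * invOneAdd) := by
  have h0 : eulerOp motzkinGF = eulerOp conicParam + 2 * conicParam * eulerOp conicParam := by
    conv_lhs => rw [motzkinGF_eq]
    rw [map_add, map_add, Derivation.map_one_eq_zero, pow_two, Derivation.leibniz, smul_eq_mul]
    ring
  have h1 : eulerOp conicParam = conicParam + X * eulerOp motzkinGF := by
    conv_lhs => rw [conicParam, eulerOp_X_mul]
    rfl
  have hX : X * motzkinGF = conicParam := rfl
  -- Multiply θu = u + x(1 + 2u)θu by M; then M - u(1 + 2u) = 1 - u².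
  have h2 : eulerOp conicParam * ((1 - conicParam) * (1 + conicParam)) =
      conicParam * motzkinGF := by
    rw [h0] at h1
    linear_combination motzkinGF * h1 + (eulerOp conicParam + 2 * conicParam * eulerOp conicParam) * hX
      - eulerOp conicParam * motzkinGF_eq
  linear_combination (invOneSub * invOneAdd) * h2 - eulerOp conicParam * invOneAdd_mul
   - eulerOp conicParam * invOneAdd * (1 + conicParam) * invOneSub_mul

theorem eulerOp_motzkinGF : eulerOp motzkinGF =
    motzkinGF * ((1 + 2 * conicParam) * conicParam * (invOneSub * invOneAdd)) := by
  conv_lhs => rw [motzkinGF_eq]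
  rw [map_add, map_add, Derivation.map_one_eq_zero, pow_two, Derivation.leibniz, smul_eq_mul,
    eulerOp_conicParam]
  ring

theorem eulerOp_invOneSub : eulerOp invOneSub =
    invOneSub ^ 2 * (conicParam * motzkinGF * (invOneSub * invOneAdd)) := by
  have h := congrArg eulerOp invOneSub_mul
  rw [Derivation.leibniz, map_sub, Derivation.map_one_eq_zero, smul_eq_mul, smul_eq_mul,
    eulerOp_conicParam] at h
  linear_combination invOneSub * h - eulerOp invOneSub * invOneSub_mul

theorem eulerOp_invOneAdd : eulerOp invOneAdd =
    -invOneAdd ^ 2 * (conicParam * motzkinGF * (invOneSub * invOneAdd)) := by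
  have h := congrArg eulerOp invOneAdd_mul
  rw [Derivation.leibniz, map_add, Derivation.map_one_eq_zero, smul_eq_mul, smul_eq_mul,
    eulerOp_conicParam] at h
  linear_combination invOneAdd * h - eulerOp invOneAdd * invOneAdd_mul

theorem conicParam_mul_invOneSub : conicParam * invOneSub = invOneSub - 1 := by
  linear_combination -invOneSub_mul

theorem conicParam_mul_invOneAdd : conicParam * invOneAdd = 1 - invOneAdd := by
  linear_combination invOneAdd_mul

/-! ### Membership of the area series in M·R -/

/-- The algebra of the rational functions of `u` that are regular away from `u = 1, -1`. -/
noncomputable def resolventAlg : Subalgebra ℚ ℚ⟦X⟧ := Algebra.adjoin ℚ {invOneSub, invOneAdd}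

theorem invOneSub_mem : invOneSub ∈ resolventAlg := Algebra.subset_adjoin (by simp)

theorem invOneAdd_mem : invOneAdd ∈ resolventAlg := Algebra.subset_adjoin (by simp)

/-- `u` has a pole at infinity and is not in the algebra, so each factor `u` has to be paired with
an inverse. -/
theorem conicParam_mul_invOneSub_mem : conicParam * invOneSub ∈ resolventAlg := by
  rw [conicParam_mul_invOneSub]
  exact sub_mem invOneSub_mem (one_mem _)

theorem conicParam_mul_invOneAdd_mem : conicParam * invOneAdd ∈ resolventAlg := by
  rw [conicParam_mul_invOneAdd]
  exact sub_mem (one_mem _) invOneAdd_mem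

theorem eulerOp_mem_resolventAlg {g : ℚ⟦X⟧} (hg : g ∈ resolventAlg) : eulerOp g ∈ resolventAlg := by
  have ha := invOneSub_mem
  have hb := invOneAdd_mem
  have hua := conicParam_mul_invOneSub_mem
  have hub := conicParam_mul_invOneAdd_mem
  induction hg using Algebra.adjoin_induction with
  | mem x hx =>
    rcases hx with rfl | rfl
    · have e : eulerOp invOneSub = conicParam * invOneSub * invOneSub ^ 2 * invOneAdd
          + (conicParam * invOneSub) ^ 2 * (invOneSub * invOneAdd)
          + (conicParam * invOneSub) ^ 3 * invOneAdd := by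
        rw [eulerOp_invOneSub, motzkinGF_eq]; ring
      rw [e]
      exact add_mem (add_mem (mul_mem (mul_mem hua (pow_mem ha 2)) hb)
        (mul_mem (pow_mem hua 2) (mul_mem ha hb))) (mul_mem (pow_mem hua 3) hb)
    · have e : eulerOp invOneAdd = -(conicParam * invOneAdd * invOneAdd ^ 2 * invOneSub
          + (conicParam * invOneAdd) ^ 2 * (invOneSub * invOneAdd)
          + (conicParam * invOneAdd) ^ 3 * invOneSub) := by
        rw [eulerOp_invOneAdd, motzkinGF_eq]; ring
      rw [e]
      exact neg_mem (add_mem (add_mem (mul_mem (mul_mem hub (pow_mem hb 2)) ha)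
        (mul_mem (pow_mem hub 2) (mul_mem ha hb))) (mul_mem (pow_mem hub 3) ha))
  | algebraMap r => rw [Derivation.map_algebraMap]; exact zero_mem _
  | add x y _ _ hx hy => rw [map_add]; exact add_mem hx hy
  | mul x y hx' hy' hx hy =>
    rw [Derivation.leibniz, smul_eq_mul, smul_eq_mul]
    exact add_mem (mul_mem hx' hy) (mul_mem hy' hx)

theorem eulerOp_motzkinGF_mul (g : ℚ⟦X⟧) : eulerOp (motzkinGF * g) = motzkinGF *
    ((1 + 2 * conicParam) * conicParam * (invOneSub * invOneAdd) * g + eulerOp g) := by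
  rw [Derivation.leibniz, eulerOp_motzkinGF, smul_eq_mul, smul_eq_mul]
  ring

/-- The multiples of the Motzkin generating function by elements of `resolventAlg`. -/
noncomputable def motzkinModule : Submodule ℚ ℚ⟦X⟧ :=
  (Subalgebra.toSubmodule resolventAlg).map (LinearMap.mulLeft ℚ motzkinGF)

theorem mem_motzkinModule {p : ℚ⟦X⟧} :
    p ∈ motzkinModule ↔ ∃ g ∈ resolventAlg, motzkinGF * g = p := by
  simp [motzkinModule]

theorem eulerOp_mem_motzkinModule {p : ℚ⟦X⟧} (hp : p ∈ motzkinModule) :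
    eulerOp p ∈ motzkinModule := by
  obtain ⟨g, hg, rfl⟩ := mem_motzkinModule.1 hp
  refine mem_motzkinModule.2 ⟨_, ?_, (eulerOp_motzkinGF_mul g).symm⟩
  refine add_mem (mul_mem ?_ hg) (eulerOp_mem_resolventAlg hg)
  have e : (1 + 2 * conicParam) * conicParam * (invOneSub * invOneAdd) =
      conicParam * invOneSub * invOneAdd
      + (conicParam * invOneSub * (conicParam * invOneAdd)
        + conicParam * invOneSub * (conicParam * invOneAdd)) := by ring
  rw [e]
  have h := mul_mem conicParam_mul_invOneSub_mem conicParam_mul_invOneAdd_mem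
  exact add_mem (mul_mem conicParam_mul_invOneSub_mem invOneAdd_mem) (add_mem h h)

theorem succEulerOp_pow_mem_motzkinModule (i : ℕ) {p : ℚ⟦X⟧} (hp : p ∈ motzkinModule) :
    (succEulerOp ^ i) p ∈ motzkinModule := by
  induction i with
  | zero => simpa using hp
  | succ i ih =>
    rw [pow_succ', Module.End.mul_apply, succEulerOp_apply]
    exact add_mem ih (eulerOp_mem_motzkinModule ih)

/-- Only the term without Euler operators involves the coefficient of order `r`; the others come
from lower orders. -/
theorem tCoeff_rescale_sub_mem {f : ℚ⟦X⟧⟦X⟧} {r : ℕ}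
    (h : ∀ j < r, tCoeff j f ∈ motzkinModule) :
    tCoeff r (C (expMul 1) * rescale (expMul 1) f) - tCoeff r f ∈ motzkinModule := by
  have e : tCoeff r f = ∑ p ∈ Finset.HasAntidiagonal.antidiagonal r,
      if p = (0, r) then tCoeff r f else 0 := by
    rw [Finset.sum_ite_eq', if_pos (by simp)]
  rw [e, tCoeff_rescale, ← Finset.sum_sub_distrib]
  refine sum_mem fun p hp => ?_
  have hp := Finset.HasAntidiagonal.mem_antidiagonal.1 hp
  obtain ⟨i, j⟩ := p
  dsimp only at hp ⊢
  split_ifs with h0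
  · obtain ⟨rfl, rfl⟩ := Prod.mk.inj h0
    simp
  · rw [sub_zero]
    refine Submodule.smul_mem _ _ (succEulerOp_pow_mem_motzkinModule _ (h _ ?_))
    rcases Nat.eq_zero_or_pos i with rfl | hi
    · exact absurd (by simp_all) h0
    · omega

/-- The multiples of `u ^ 2` by elements of `resolventAlg`. -/
noncomputable def sqModule : Submodule ℚ ℚ⟦X⟧ :=
  (Subalgebra.toSubmodule resolventAlg).map (LinearMap.mulLeft ℚ (conicParam ^ 2))

theorem mem_sqModule {p : ℚ⟦X⟧} :
    p ∈ sqModule ↔ ∃ g ∈ resolventAlg, conicParam ^ 2 * g = p := by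
  simp [sqModule]

theorem X_sq_mul_mem_sqModule {p q : ℚ⟦X⟧} (hp : p ∈ motzkinModule) (hq : q ∈ motzkinModule) :
    X ^ 2 * (p * q) ∈ sqModule := by
  obtain ⟨g, hg, rfl⟩ := mem_motzkinModule.1 hp
  obtain ⟨h, hh, rfl⟩ := mem_motzkinModule.1 hq
  exact mem_sqModule.2 ⟨_, mul_mem hg hh, by rw [conicParam]; ring⟩

theorem mem_motzkinModule_of_mul_mem {p : ℚ⟦X⟧}
    (hp : p * (1 - X - 2 * X ^ 2 * motzkinGF) ∈ sqModule) : p ∈ motzkinModule := by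
  obtain ⟨g, hg, h⟩ := mem_sqModule.1 hp
  refine mem_motzkinModule.2 ⟨_, mul_mem (mul_mem conicParam_mul_invOneSub_mem
    conicParam_mul_invOneAdd_mem) hg, ?_⟩
  have hX : X * motzkinGF = conicParam := rfl
  have h2 : p * ((1 - conicParam) * (1 + conicParam)) = motzkinGF * (conicParam ^ 2 * g) := by
    rw [h]
    linear_combination (-p) * motzkinGF_eq + (p * (1 + 2 * X * motzkinGF + 2 * conicParam)) * hX
  linear_combination (-(invOneSub * invOneAdd)) * h2 + p * invOneAdd_mul
   + p * invOneAdd * (1 + conicParam) * invOneSub_mul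

theorem one_mem_motzkinModule : motzkinGF ∈ motzkinModule :=
  mem_motzkinModule.2 ⟨1, one_mem _, mul_one _⟩

theorem tCoeff_areaGF_mem (r : ℕ) : tCoeff r areaGF ∈ motzkinModule := by
  induction r using Nat.strong_induction_on with
  | _ r ih =>
  rcases Nat.eq_zero_or_pos r with rfl | hr
  · rw [tCoeff_zero_areaGF]; exact one_mem_motzkinModule
  apply mem_motzkinModule_of_mul_mem
  set m := tCoeff r areaGF with hm
  set G : ℚ⟦X⟧⟦X⟧ := C (expMul 1) * rescale (expMul 1) areaGF with hG
  have hG0 : tCoeff 0 G = motzkinGF := by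
    rw [hG, tCoeff_rescale]; simp [tCoeff_zero_areaGF]
  have h := congrArg (tCoeff r) areaGF_eq
  have hX := tCoeff_X_pow_mul r 1 areaGF
  rw [pow_one, pow_one] at hX
  rw [tCoeff_add, tCoeff_add, tCoeff_one, hX, tCoeff_X_pow_mul, if_neg hr.ne', ← hm, ← hG,
    tCoeff_mul] at h
  have e (q : ℕ × ℕ) (hq : q ∈ Finset.HasAntidiagonal.antidiagonal r) : motzkinGF * m =
      ∑ p ∈ Finset.HasAntidiagonal.antidiagonal r, if p = q then motzkinGF * m else 0 := by
    rw [Finset.sum_ite_eq', if_pos hq]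
  -- The unknown `m` enters through both extreme terms of the convolution, each contributing
  -- `motzkinGF * m`; moving these to the left produces the factor 2.
  have key : m * (1 - X - 2 * X ^ 2 * motzkinGF) =
      ∑ p ∈ Finset.HasAntidiagonal.antidiagonal r, X ^ 2 * (tCoeff p.1 G * tCoeff p.2 areaGF
        - (if p = (0, r) then motzkinGF * m else 0)
        - (if p = (r, 0) then motzkinGF * m else 0)) := by
    rw [← Finset.mul_sum, Finset.sum_sub_distrib, Finset.sum_sub_distrib, ← e _ (by simp),
      ← e _ (by simp)]
    linear_combination h
  rw [key]
  refine sum_mem fun p hp => ?_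
  have hp := Finset.HasAntidiagonal.mem_antidiagonal.1 hp
  obtain ⟨i, j⟩ := p
  dsimp only at hp ⊢
  rcases Nat.eq_zero_or_pos i with rfl | hi
  · obtain rfl : j = r := by omega
    rw [if_pos rfl, if_neg (by simp; omega), hG0, ← hm]
    simp
  rcases Nat.eq_zero_or_pos j with rfl | hj
  · obtain rfl : i = r := by omega
    rw [if_neg (by simp; omega), if_pos rfl, tCoeff_zero_areaGF]
    have := X_sq_mul_mem_sqModule (tCoeff_rescale_sub_mem ih) one_mem_motzkinModule
    rw [← hG, ← hm] at this
    convert this using 1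
    ring
  · rw [if_neg (by simp; omega), if_neg (by simp; omega), sub_zero, sub_zero]
    refine X_sq_mul_mem_sqModule ?_ (ih j (by omega))
    have h1 := tCoeff_rescale_sub_mem (f := areaGF) (r := i) fun k hk => ih k (by omega)
    have h2 := add_mem h1 (ih i (by omega))
    rwa [sub_add_cancel] at h2

/-! ### Coefficients of the elements of M·R -/

/-- The series whose coefficients are combinations, with coefficients that are polynomials in `n`,
of `M_n`, `M_{n+1}`, `3 ^ n` and `(-1) ^ n`. -/
noncomputable def motzkinCombinations : Submodule ℚ ℚ⟦X⟧ where
  carrier := {p | ∃ Q₁ Q₂ Q₃ Q₄ : Polynomial ℚ, ∀ n : ℕ, coeff n p =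
    Q₁.eval (n : ℚ) * (motzkinNumber n : ℚ) + Q₂.eval (n : ℚ) * (motzkinNumber (n + 1) : ℚ)
      + Q₃.eval (n : ℚ) * 3 ^ n + Q₄.eval (n : ℚ) * (-1) ^ n}
  zero_mem' := ⟨0, 0, 0, 0, by simp⟩
  add_mem' := by
    rintro p q ⟨P₁, P₂, P₃, P₄, hp⟩ ⟨Q₁, Q₂, Q₃, Q₄, hq⟩
    refine ⟨P₁ + Q₁, P₂ + Q₂, P₃ + Q₃, P₄ + Q₄, fun n => ?_⟩
    rw [map_add, hp, hq]
    simp only [Polynomial.eval_add]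
    ring
  smul_mem' := by
    rintro c p ⟨P₁, P₂, P₃, P₄, hp⟩
    refine ⟨c • P₁, c • P₂, c • P₃, c • P₄, fun n => ?_⟩
    rw [coeff_smul, hp]
    simp only [Polynomial.eval_smul, smul_eq_mul]
    ring

theorem eulerOp_mem_motzkinCombinations {p : ℚ⟦X⟧} (hp : p ∈ motzkinCombinations) :
    eulerOp p ∈ motzkinCombinations := by
  obtain ⟨P₁, P₂, P₃, P₄, hp⟩ := hp
  refine ⟨.X * P₁, .X * P₂, .X * P₃, .X * P₄, fun n => ?_⟩
  rw [coeff_eulerOp, hp]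
  simp only [Polynomial.eval_mul, Polynomial.eval_X]
  ring

theorem motzkinGF_mem : motzkinGF ∈ motzkinCombinations :=
  ⟨1, 0, 0, 0, fun n => by simp [coeff_motzkinGF]⟩

theorem motzkinGF_mul_one_add_mem : motzkinGF * (1 + conicParam) ∈ motzkinCombinations := by
  refine ⟨0, 1, 0, 0, fun n => ?_⟩
  have e : X * (motzkinGF * (1 + conicParam)) = motzkinGF - 1 := by
    have hX : X * motzkinGF = conicParam := rfl
    linear_combination (1 + conicParam) * hX - motzkinGF_eq
  rw [← coeff_succ_X_mul, e, map_sub, coeff_motzkinGF, coeff_one]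
  simp

theorem coeff_of_mul_eq_one {c : ℚ} {p : ℚ⟦X⟧} (h : p * (1 - C c * X) = 1) (n : ℕ) :
    coeff n p = c ^ n := by
  have e : p = 1 + X * (C c * p) := by linear_combination h
  induction n with
  | zero => rw [e]; simp
  | succ n ih => rw [e, map_add, coeff_succ_X_mul, coeff_C_mul, ih, coeff_one]; simp [pow_succ']

theorem motzkinGF_mul_invOneSub_sq_mem : motzkinGF * invOneSub ^ 2 ∈ motzkinCombinations := by
  refine ⟨0, 0, 1, 0, fun n => ?_⟩
  rw [coeff_of_mul_eq_one (c := 3)]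
  · simp
  · have hX : X * motzkinGF = conicParam := rfl
    rw [C_ofNat]
    -- This is (1 - u)² = M - 3u = M(1 - 3x).
    linear_combination (invOneSub * (1 - conicParam) + 1) * invOneSub_mul
      + invOneSub ^ 2 * motzkinGF_eq - 3 * invOneSub ^ 2 * hX

theorem motzkinGF_mul_invOneAdd_sq_mem : motzkinGF * invOneAdd ^ 2 ∈ motzkinCombinations := by
  refine ⟨0, 0, 0, 1, fun n => ?_⟩
  rw [coeff_of_mul_eq_one (c := -1)]
  · simp
  · have hX : X * motzkinGF = conicParam := rfl
    rw [map_neg, map_one]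
    linear_combination (invOneAdd * (1 + conicParam) + 1) * invOneAdd_mul
      + invOneAdd ^ 2 * motzkinGF_eq + invOneAdd ^ 2 * hX

/-- The series `g` such that `F g` has the coefficients wanted, for `F` the Motzkin generating
function. -/
noncomputable def motzkinMultipliers : Submodule ℚ ℚ⟦X⟧ :=
  motzkinCombinations.comap (LinearMap.mulLeft ℚ motzkinGF)

theorem mem_motzkinMultipliers {g : ℚ⟦X⟧} :
    g ∈ motzkinMultipliers ↔ motzkinGF * g ∈ motzkinCombinations := Iff.rfl

theorem mem_motzkinMultipliers_of_eulerOp {g h : ℚ⟦X⟧} (hg : g ∈ motzkinMultipliers)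
    (e : eulerOp (motzkinGF * g) = motzkinGF * h) : h ∈ motzkinMultipliers := by
  rw [mem_motzkinMultipliers, ← e]
  exact eulerOp_mem_motzkinCombinations hg

theorem mem_of_natCast_mul_mem {S : Submodule ℚ ℚ⟦X⟧} {k : ℕ} (hk : k ≠ 0) {g : ℚ⟦X⟧}
    (h : (k : ℚ⟦X⟧) * g ∈ S) : g ∈ S := by
  rw [← nsmul_eq_mul, ← Nat.cast_smul_eq_nsmul ℚ] at h
  exact (S.smul_mem_iff (Nat.cast_ne_zero.2 hk)).1 h

theorem natCast_mul_mem {S : Submodule ℚ ℚ⟦X⟧} (k : ℕ) {g : ℚ⟦X⟧} (h : g ∈ S) :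
    (k : ℚ⟦X⟧) * g ∈ S := by
  rw [← nsmul_eq_mul]
  exact nsmul_mem h k

theorem two_mul_invOneSub_mul_invOneAdd :
    2 * (invOneSub * invOneAdd) = invOneSub + invOneAdd := by
  linear_combination invOneAdd * invOneSub_mul + invOneSub * invOneAdd_mul

/-- Partial fractions: 2/((1-u)(1+u)) = 1/(1-u) + 1/(1+u) lowers the total degree of a mixed
product. -/
theorem invOneSub_pow_mul_invOneAdd_pow_mem {S : Submodule ℚ ℚ⟦X⟧} (i j : ℕ)
    (ha : ∀ k ≤ i, invOneSub ^ k ∈ S) (hb : ∀ k ≤ j, invOneAdd ^ k ∈ S) :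
    invOneSub ^ i * invOneAdd ^ j ∈ S := by
  induction hn : i + j generalizing i j with
  | zero =>
    obtain ⟨rfl, rfl⟩ : i = 0 ∧ j = 0 := by omega
    simpa using ha 0 le_rfl
  | succ n ih =>
    rcases i with _ | i
    · simpa using hb j le_rfl
    rcases j with _ | j
    · simpa using ha (i + 1) le_rfl
    refine mem_of_natCast_mul_mem two_ne_zero ?_
    have h1 := ih (i + 1) j ha (fun k hk => hb k (by omega)) (by omega)
    have h2 := ih i (j + 1) (fun k hk => ha k (by omega)) hb (by omega)
    convert add_mem h1 h2 using 1
    push_cast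
    linear_combination (invOneSub ^ i * invOneAdd ^ j) * two_mul_invOneSub_mul_invOneAdd

theorem two_mul_logDeriv_motzkinGF :
    2 * ((1 + 2 * conicParam) * conicParam * (invOneSub * invOneAdd)) =
      3 * invOneSub + invOneAdd - 4 := by
  have e : (1 + 2 * conicParam) * conicParam * (invOneSub * invOneAdd) =
    (conicParam * invOneSub) * invOneAdd + 2 * (conicParam * invOneSub) * (conicParam * invOneAdd) := by
    ring
  rw [e, conicParam_mul_invOneSub, conicParam_mul_invOneAdd]
  linear_combination -two_mul_invOneSub_mul_invOneAdd

theorem four_mul_logDeriv_invOneSub :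
    4 * (invOneSub * (conicParam * motzkinGF * (invOneSub * invOneAdd))) =
      4 + 6 * invOneSub ^ 2 - 9 * invOneSub - invOneAdd := by
  have e : invOneSub * (conicParam * motzkinGF * (invOneSub * invOneAdd)) =
      (conicParam * invOneSub) * (invOneSub * invOneAdd) + (conicParam * invOneSub) ^ 2 * invOneAdd
      + (conicParam * invOneSub) ^ 2 * (conicParam * invOneAdd) := by
    rw [motzkinGF_eq]; ring
  rw [e, conicParam_mul_invOneSub, conicParam_mul_invOneAdd]
  linear_combination (2 * invOneSub - 1) * two_mul_invOneSub_mul_invOneAdd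

theorem four_mul_logDeriv_invOneAdd :
    4 * (invOneAdd * (conicParam * motzkinGF * (invOneSub * invOneAdd))) =
      3 * invOneSub + 3 * invOneAdd - 2 * invOneAdd ^ 2 - 4 := by
  have e : invOneAdd * (conicParam * motzkinGF * (invOneSub * invOneAdd)) =
      (conicParam * invOneAdd) * (invOneSub * invOneAdd) + (conicParam * invOneAdd) ^ 2 * invOneSub
      + (conicParam * invOneAdd) ^ 2 * (conicParam * invOneSub) := by
    rw [motzkinGF_eq]; ring
  rw [e, conicParam_mul_invOneSub, conicParam_mul_invOneAdd]
  linear_combination (2 * invOneAdd - 5) * two_mul_invOneSub_mul_invOneAdd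

theorem one_mem_motzkinMultipliers : (1 : ℚ⟦X⟧) ∈ motzkinMultipliers := by
  rw [mem_motzkinMultipliers, mul_one]
  exact motzkinGF_mem

theorem three_mul_invOneSub_add_invOneAdd_mem :
    3 * invOneSub + invOneAdd ∈ motzkinMultipliers := by
  have h1 := mem_motzkinMultipliers_of_eulerOp one_mem_motzkinMultipliers (eulerOp_motzkinGF_mul 1)
  have h2 := add_mem (natCast_mul_mem 2 h1) (natCast_mul_mem 4 one_mem_motzkinMultipliers)
  convert h2 using 1
  rw [Derivation.map_one_eq_zero]
  push_cast
  linear_combination -two_mul_logDeriv_motzkinGF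

/-- Applying θ to M(1 + u) gives a second combination of the two simple poles, independent of the
one obtained from M. -/
theorem nine_mul_invOneSub_sub_invOneAdd_mem :
    9 * invOneSub - invOneAdd ∈ motzkinMultipliers := by
  have h0 : 1 + conicParam ∈ motzkinMultipliers := motzkinGF_mul_one_add_mem
  have h1 := mem_motzkinMultipliers_of_eulerOp h0 (eulerOp_motzkinGF_mul _)
  have h2 := add_mem (natCast_mul_mem 2 (add_mem h1 (natCast_mul_mem 3 h0)))
    (natCast_mul_mem 2 one_mem_motzkinMultipliers)
  convert h2 using 1
  have e1 : (1 + 2 * conicParam) * conicParam * (invOneSub * invOneAdd) * (1 + conicParam) =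
      3 * invOneSub - 3 - 2 * conicParam := by
    linear_combination ((1 + 2 * conicParam) * conicParam * invOneSub) * invOneAdd_mul
      + (1 + 2 * conicParam) * conicParam_mul_invOneSub + 2 * conicParam_mul_invOneSub
  have e2 : conicParam * motzkinGF * (invOneSub * invOneAdd) =
      invOneSub * invOneAdd - invOneAdd + invOneSub - 1 - conicParam := by
    have e : conicParam * motzkinGF * (invOneSub * invOneAdd) =
        (conicParam * invOneSub) * invOneAdd
        + (conicParam * invOneSub) * (conicParam * invOneAdd) * (1 + conicParam) := by
      rw [motzkinGF_eq]; ring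
    rw [e, conicParam_mul_invOneSub, conicParam_mul_invOneAdd]
    linear_combination (1 - invOneSub) * invOneAdd_mul + conicParam_mul_invOneSub
  rw [map_add, Derivation.map_one_eq_zero, eulerOp_conicParam, e1, e2]
  push_cast
  linear_combination -two_mul_invOneSub_mul_invOneAdd

theorem invOneSub_mem_motzkinMultipliers : invOneSub ∈ motzkinMultipliers := by
  refine mem_of_natCast_mul_mem (k := 12) (by norm_num) ?_
  convert add_mem three_mul_invOneSub_add_invOneAdd_mem nine_mul_invOneSub_sub_invOneAdd_mem using 1
  push_cast
  ring

theorem invOneAdd_mem_motzkinMultipliers : invOneAdd ∈ motzkinMultipliers := by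
  convert sub_mem three_mul_invOneSub_add_invOneAdd_mem
    (natCast_mul_mem 3 invOneSub_mem_motzkinMultipliers) using 1
  push_cast
  ring

theorem invOneSub_pow_mem (k : ℕ) : invOneSub ^ k ∈ motzkinMultipliers := by
  induction k using Nat.strong_induction_on with
  | _ k ih =>
  match k with
  | 0 => simpa using one_mem_motzkinMultipliers
  | 1 => simpa using invOneSub_mem_motzkinMultipliers
  | 2 => exact motzkinGF_mul_invOneSub_sq_mem
  | k + 3 =>
    have h1 := ih (k + 1) (by omega)
    have h2 := ih (k + 2) (by omega)
    have hab : invOneSub ^ (k + 1) * invOneAdd ∈ motzkinMultipliers := by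
      simpa using invOneSub_pow_mul_invOneAdd_pow_mem (k + 1) 1 (fun i hi => ih i (by omega))
        fun j hj => by
          rcases (by omega : j = 0 ∨ j = 1) with rfl | rfl
          · simpa using one_mem_motzkinMultipliers
          · simpa using invOneAdd_mem_motzkinMultipliers
    have h := mem_motzkinMultipliers_of_eulerOp h1 (eulerOp_motzkinGF_mul _)
    -- The leading term 6/(1-u)² of `four_mul_logDeriv_invOneSub`, times the exponent `k + 1`; it is
    -- nonzero, so θ really reaches the power `k + 3`.
    refine mem_of_natCast_mul_mem (k := 6 * (k + 1)) (by omega) ?_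
    have e : ((6 * (k + 1) : ℕ) : ℚ⟦X⟧) * invOneSub ^ (k + 3) =
        (4 : ℕ) * ((1 + 2 * conicParam) * conicParam * (invOneSub * invOneAdd) * invOneSub ^ (k + 1)
          + eulerOp (invOneSub ^ (k + 1)))
        + (8 : ℕ) * invOneSub ^ (k + 1) + (9 * (k + 1) : ℕ) * invOneSub ^ (k + 2)
        + (k + 1 : ℕ) * (invOneSub ^ (k + 1) * invOneAdd)
        - (6 : ℕ) * invOneSub ^ (k + 2) - (2 : ℕ) * (invOneSub ^ (k + 1) * invOneAdd)
        - (4 * (k + 1) : ℕ) * invOneSub ^ (k + 1) := by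
      rw [Derivation.leibniz_pow, eulerOp_invOneSub, Nat.add_sub_cancel, nsmul_eq_mul, smul_eq_mul]
      push_cast
      linear_combination (-2 * invOneSub ^ (k + 1)) * two_mul_logDeriv_motzkinGF
        - ((k + 1) * invOneSub ^ (k + 1)) * four_mul_logDeriv_invOneSub
    rw [e]
    exact sub_mem (sub_mem (sub_mem (add_mem (add_mem (add_mem (natCast_mul_mem _ h)
      (natCast_mul_mem _ h1)) (natCast_mul_mem _ h2)) (natCast_mul_mem _ hab))
      (natCast_mul_mem _ h2)) (natCast_mul_mem _ hab)) (natCast_mul_mem _ h1)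

theorem invOneAdd_pow_mem (k : ℕ) : invOneAdd ^ k ∈ motzkinMultipliers := by
  induction k using Nat.strong_induction_on with
  | _ k ih =>
  match k with
  | 0 => simpa using one_mem_motzkinMultipliers
  | 1 => simpa using invOneAdd_mem_motzkinMultipliers
  | 2 => exact motzkinGF_mul_invOneAdd_sq_mem
  | k + 3 =>
    have h1 := ih (k + 1) (by omega)
    have h2 := ih (k + 2) (by omega)
    have hab : invOneSub * invOneAdd ^ (k + 1) ∈ motzkinMultipliers := by
      simpa using invOneSub_pow_mul_invOneAdd_pow_mem 1 (k + 1) (fun i _ => invOneSub_pow_mem i)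
        (fun i hi => ih i (by omega))
    have h := mem_motzkinMultipliers_of_eulerOp h1 (eulerOp_motzkinGF_mul _)
    refine mem_of_natCast_mul_mem (k := 2 * (k + 1)) (by omega) ?_
    have e : ((2 * (k + 1) : ℕ) : ℚ⟦X⟧) * invOneAdd ^ (k + 3) =
        (4 : ℕ) * ((1 + 2 * conicParam) * conicParam * (invOneSub * invOneAdd) * invOneAdd ^ (k + 1)
          + eulerOp (invOneAdd ^ (k + 1)))
        + (8 : ℕ) * invOneAdd ^ (k + 1) + (3 * (k + 1) : ℕ) * invOneAdd ^ (k + 2)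
        + (3 * (k + 1) : ℕ) * (invOneSub * invOneAdd ^ (k + 1))
        - (2 : ℕ) * invOneAdd ^ (k + 2) - (6 : ℕ) * (invOneSub * invOneAdd ^ (k + 1))
        - (4 * (k + 1) : ℕ) * invOneAdd ^ (k + 1) := by
      rw [Derivation.leibniz_pow, eulerOp_invOneAdd, Nat.add_sub_cancel, nsmul_eq_mul, smul_eq_mul]
      push_cast
      linear_combination (-2 * invOneAdd ^ (k + 1)) * two_mul_logDeriv_motzkinGF
        + ((k + 1) * invOneAdd ^ (k + 1)) * four_mul_logDeriv_invOneAdd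
    rw [e]
    exact sub_mem (sub_mem (sub_mem (add_mem (add_mem (add_mem (natCast_mul_mem _ h)
      (natCast_mul_mem _ h1)) (natCast_mul_mem _ h2)) (natCast_mul_mem _ hab))
      (natCast_mul_mem _ h2)) (natCast_mul_mem _ hab)) (natCast_mul_mem _ h1)

theorem resolventAlg_le_motzkinMultipliers :
    Subalgebra.toSubmodule resolventAlg ≤ motzkinMultipliers := by
  rw [resolventAlg, Algebra.adjoin_eq_span, Submodule.span_le]
  intro x hx
  obtain ⟨i, j, rfl⟩ := (Submonoid.mem_closure_pair _ _ _).1 hx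
  exact invOneSub_pow_mul_invOneAdd_pow_mem i j (fun k _ => invOneSub_pow_mem k)
    fun k _ => invOneAdd_pow_mem k

theorem fact2 (r : ℕ) :
    ∃ Q₁ Q₂ Q₃ Q₄ : Polynomial ℚ, ∀ n : ℕ,
      motzkinAreaPowerSum r n =
        Q₁.eval (n : ℚ) * (motzkinNumber n : ℚ)
          + Q₂.eval (n : ℚ) * (motzkinNumber (n + 1) : ℚ)
          + Q₃.eval (n : ℚ) * 3 ^ n
          + Q₄.eval (n : ℚ) * (-1) ^ n := by
  obtain ⟨g, hg, h⟩ := mem_motzkinModule.1 (tCoeff_areaGF_mem r)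
  have hg' : motzkinGF * g ∈ motzkinCombinations := resolventAlg_le_motzkinMultipliers hg
  rw [h] at hg'
  obtain ⟨Q₁, Q₂, Q₃, Q₄, hQ⟩ := motzkinCombinations.smul_mem (r.factorial : ℚ) hg'
  refine ⟨Q₁, Q₂, Q₃, Q₄, fun n => ?_⟩
  rw [← hQ, coeff_smul, coeff_tCoeff, coeff_coeff_areaGF, smul_eq_mul,
    mul_div_cancel₀ _ (Nat.cast_ne_zero.2 r.factorial_ne_zero)]
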